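/- Let $\mathcal H$ be a separable complex Hilbert space. For $0<p<\infty$ and a compact operator $A\in B(\mathcal H)$ put $\|A\|_p=(\operatorname{tr}|A|^p)^{1/p}$, where $|A|=(A^*A)^{1/2}$, and let $C_p$ be the set of compact $A\in B(\mathcal H)$ with $\|A\|_p<\infty$. Let $p>0$ and let $A_1,\dots,A_n,B_1,\dots,B_n\in C_p$ be such that $\sum_{i,j=1}^n A_i^*B_j=0$. Then the operators $A_i\pm B_j$ and $(|A_i|^2+|B_i|^2)^{1/2}$ belong to $C_p$ for all $i,j$, and $$\sum_{i,j=1}^n\|A_i\pm B_j\|_p^2\;\le\; n^{2/p}\sum_{i=1}^n\left\|\left(|A_i|^2+|B_i|^2\right)^{1/2}\right\|_p^2\qquad\text{for }0<p\le 2,$$ $$n^{2/p}\sum_{i=1}^n\left\|\left(|A_i|^2+|B_i|^2\right)^{1/2}\right\|_p^2\;\le\;\sum_{i,j=1}^n\|A_i\pm B_j\|_p^2\qquad\text{for }2\le p<\infty.$$ Here each inequality with $\pm$ stands for two inequalities, one with $+$ in all terms and one with $-$ in all terms. -/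

import Mathlib

open scoped ENNReal InnerProductSpace

noncomputable section

namespace Schatten

/-- Parseval's identity in `[0, ∞]`. -/
theorem tsum_inner_sq {H : Type*} [NormedAddCommGroup H] [InnerProductSpace ℂ H]
    {ι : Type*} (e : HilbertBasis ι ℂ H) (x : H) :
    ∑' i, ENNReal.ofReal (‖⟪e i, x⟫_ℂ‖ ^ 2) = ENNReal.ofReal (‖x‖ ^ 2) := by
  have h := e.hasSum_inner_mul_inner x x
  have h2 : HasSum (fun i => ‖⟪e i, x⟫_ℂ‖ ^ 2) (‖x‖ ^ 2) := by
    have h1 : ∀ i, ⟪x, e i⟫_ℂ * ⟪e i, x⟫_ℂ = ((‖⟪e i, x⟫_ℂ‖ ^ 2 : ℝ) : ℂ) := fun i => by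
      rw [← inner_conj_symm x (e i), Complex.conj_mul', Complex.ofReal_pow]
    have h3 : ⟪x, x⟫_ℂ = ((‖x‖ ^ 2 : ℝ) : ℂ) := by
      rw [inner_self_eq_norm_sq_to_K, Complex.ofReal_pow]; rfl
    simp only [h1, h3] at h
    exact Complex.hasSum_ofReal.mp h
  rw [← h2.tsum_eq, ENNReal.ofReal_tsum_of_nonneg (fun _ => by positivity) h2.summable]

variable {H : Type*} [NormedAddCommGroup H] [InnerProductSpace ℂ H] [CompleteSpace H]

/-- The sum `∑ i, ⟪e i, T (e i)⟫` along the orthonormal basis `e`, as an element of `[0, ∞]`.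
It is meant for positive operators `T`, whose diagonal entries are nonnegative reals. -/
def traceAlong {ι : Type*} (e : HilbertBasis ι ℂ H) (T : H →L[ℂ] H) : ℝ≥0∞ :=
  ∑' i, ENNReal.ofReal (RCLike.re ⟪e i, T (e i)⟫_ℂ)

/-- The usual trace, in `[0, ∞]`, of a positive bounded operator: the sum of the diagonal entries
along an orthonormal basis. By `traceAlong_eq_trace` the basis does not matter. -/
def trace (T : H →L[ℂ] H) : ℝ≥0∞ :=
  traceAlong (exists_hilbertBasis ℂ H).choose_spec.choose T

/-- `tr (|A| ^ p)` in `[0, ∞]`, where `|A| = (A* A)^(1/2)`; absolute value and power are those of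
the continuous functional calculus. -/
def traceAbsPow (p : ℝ) (A : H →L[ℂ] H) : ℝ≥0∞ :=
  trace (CFC.abs A ^ p)

/-- The Schatten class `C_p`: the compact operators `A` with `tr (|A| ^ p) < ∞`. -/
def schattenClass (p : ℝ) (H : Type*) [NormedAddCommGroup H] [InnerProductSpace ℂ H]
    [CompleteSpace H] : Set (H →L[ℂ] H) :=
  {A | IsCompactOperator A ∧ traceAbsPow p A < ∞}

/-- The Schatten (quasi-)norm `‖A‖_p = (tr (|A| ^ p)) ^ (1 / p)`; meaningful for `A ∈ C_p`. -/
def schattenNorm (p : ℝ) (A : H →L[ℂ] H) : ℝ :=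
  (traceAbsPow p A).toReal ^ (1 / p)

/-- The positive operator `(|A|² + |B|²)^(1/2)`. -/
def sqrtSumAbsSq (A B : H →L[ℂ] H) : H →L[ℂ] H :=
  CFC.sqrt (CFC.abs A ^ 2 + CFC.abs B ^ 2)

/-- The trace of a positive operator does not depend on the orthonormal basis. -/
theorem traceAlong_eq_trace {ι : Type*} (e : HilbertBasis ι ℂ H) {T : H →L[ℂ] H} (hT : 0 ≤ T) :
    traceAlong e T = trace T := by
  have key : ∀ x, RCLike.re ⟪x, T x⟫_ℂ = ‖CFC.sqrt T x‖ ^ 2 := by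
    intro x
    have hs : IsSelfAdjoint (CFC.sqrt T) := (CFC.sqrt_nonneg T).isSelfAdjoint
    conv_lhs => rw [← CFC.sqrt_mul_sqrt_self T hT]
    rw [mul_apply_eq_comp, ← ContinuousLinearMap.adjoint_inner_left,
      ← ContinuousLinearMap.star_eq_adjoint, hs.star_eq, ← inner_self_eq_norm_sq (𝕜 := ℂ)]
  have hs : IsSelfAdjoint (CFC.sqrt T) := (CFC.sqrt_nonneg T).isSelfAdjoint
  unfold trace traceAlong
  generalize (exists_hilbertBasis ℂ H).choose_spec.choose = f
  simp only [key]
  calc _ = ∑' i, ∑' j, ENNReal.ofReal (‖⟪f j, CFC.sqrt T (e i)⟫_ℂ‖ ^ 2) := by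
        simp only [tsum_inner_sq]
    _ = ∑' j, ∑' i, ENNReal.ofReal (‖⟪f j, CFC.sqrt T (e i)⟫_ℂ‖ ^ 2) := ENNReal.tsum_comm
    _ = ∑' j, ∑' i, ENNReal.ofReal (‖⟪e i, CFC.sqrt T (f j)⟫_ℂ‖ ^ 2) := by
        congr! 6 with j i
        rw [← ContinuousLinearMap.adjoint_inner_left, ← ContinuousLinearMap.star_eq_adjoint,
          hs.star_eq, ← inner_conj_symm, RCLike.norm_conj]
    _ = _ := by simp only [tsum_inner_sq]

end Schatten

end

/-!
Put `q = p / 2`, `X i j = |A i ± B j|²` and `Y i = |A i|² + |B i|²`. For a positive compact operator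
`T` let `N T = (tr (T ^ q)) ^ (1 / q)` (`posNorm`), so that `‖A‖_p ^ 2 = N (|A|²)`. Expanding the
squares, the hypothesis `∑ i, ∑ j, (A i)* (B j) = 0` removes the mixed terms and leaves
`∑ i, ∑ j, X i j = n • ∑ i, Y i`. For `q ≥ 1` this gives

`∑ i, ∑ j, N (X i j) ≥ N (∑ i, ∑ j, X i j) = n N (∑ i, Y i) ≥ n (∑ i, N (Y i) ^ q) ^ (1 / q)
  ≥ n ^ (1 / q) ∑ i, N (Y i)`,

by the triangle inequality for `N` (`trace_rpow_add_le`), by superadditivity of `T ↦ tr (T ^ q)`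
(`trace_rpow_superadd`), and by the power mean inequality. For `q ≤ 1` all three are reversed
(`trace_rpow_add_ge`, `trace_rpow_subadd`).

The two triangle inequalities come from Minkowski's inequality for sequences. In an orthonormal
eigenbasis `e` of `S + T` one has `tr ((S + T) ^ q) = ∑ i, (⟪e i, S (e i)⟫ + ⟪e i, T (e i)⟫) ^ q`,
and Jensen's inequality (`quad_rpow_le`, `quad_rpow_le_rpow_quad`) compares `⟪e i, S (e i)⟫ ^ q`
with `⟪e i, S ^ q (e i)⟫`.

For super- and subadditivity write `Z = S + T` and, with `R = Z ^ ((q - 1) / 2)`, split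
`tr (Z ^ q) = tr (R Z R) = tr (R S R) + tr (R T R)`. In an eigenbasis `f` of `S` with eigenvalues
`l`, `tr (R S R) = ∑ j, l j * ⟪f j, Z ^ (q - 1) (f j)⟫` (`trace_conj_eq_tsum`), and
`⟪f j, Z ^ (q - 1) (f j)⟫` is compared with `l j ^ (q - 1)` using `S ≤ Z` and operator monotonicity
or Jensen's inequality. For `q < 1` the exponent is negative, so `Z` is replaced in `R` by `Z + ε`,
and `ε` tends to `0` at the end.

The class memberships follow from the same inequalities, since `|A + B|²` is one of two positive
summands of `2 (|A|² + |B|²)`.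
-/

namespace Schatten

open Filter Topology

/-! ### Eigenvectors and the functional calculus -/

/-- `e` is an orthonormal basis of eigenvectors of `T`, with real eigenvalues `l i`. -/
def IsEigenbasis {H : Type*} [NormedAddCommGroup H] [InnerProductSpace ℂ H] {ι : Type*}
    (T : H →L[ℂ] H) (e : HilbertBasis ι ℂ H) (l : ι → ℝ) : Prop :=
  ∀ i, T (e i) = (l i : ℂ) • e i

/-- The spectral theorem for compact self-adjoint operators: orthonormal bases of the eigenspaces
combine to an orthonormal basis of the whole space. -/
theorem exists_isEigenbasis.{u} {H : Type u} [NormedAddCommGroup H] [InnerProductSpace ℂ H]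
    [CompleteSpace H] {T : H →L[ℂ] H} (hT : IsSelfAdjoint T) (hc : IsCompactOperator T) :
    ∃ (ι : Type u) (e : HilbertBasis ι ℂ H) (l : ι → ℝ), IsEigenbasis T e l := by
  have hs : (T : H →ₗ[ℂ] H).IsSymmetric := hT.isSymmetric
  have hcl : ∀ μ : ℂ, CompleteSpace (Module.End.eigenspace (T : H →ₗ[ℂ] H) μ) := fun μ => by
    have h : IsClosed ((Module.End.eigenspace (T : H →ₗ[ℂ] H) μ : Submodule ℂ H) : Set H) := by
      have : ((Module.End.eigenspace (T : H →ₗ[ℂ] H) μ : Submodule ℂ H) : Set H) =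
          {x | T x = μ • x} := by
        ext x
        simp
      rw [this]
      exact isClosed_eq T.continuous (continuous_const_smul μ)
    exact h.completeSpace_coe
  choose w b hb using fun μ : ℂ => exists_hilbertBasis ℂ (Module.End.eigenspace (T : H →ₗ[ℂ] H) μ)
  have hon := hs.orthogonalFamily_eigenspaces.orthonormal_sigma_orthonormal
    (fun μ => (b μ).orthonormal)
  have hbot := ContinuousLinearMap.orthogonalComplement_iSup_eigenspaces_eq_bot hc hs
  refine ⟨_, HilbertBasis.mkOfOrthogonalEqBot hon ?_, fun i => i.1.re, fun i => ?_⟩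
  · refine le_antisymm (fun x hx => ?_) bot_le
    rw [← hbot, ← Submodule.iInf_orthogonal, Submodule.mem_iInf]
    refine fun μ => (Submodule.mem_orthogonal' _ x).2 fun y hy => ?_
    have h0 : (innerSL ℂ x).comp (Module.End.eigenspace (T : H →ₗ[ℂ] H) μ).subtypeL = 0 := by
      refine ContinuousLinearMap.ext_on (s := Set.range (b μ))
        (Submodule.dense_iff_topologicalClosure_eq_top.2 (b μ).dense_span) ?_
      rintro _ ⟨j, rfl⟩
      exact (Submodule.mem_orthogonal' _ x).1 hx _ (Submodule.subset_span ⟨⟨μ, j⟩, rfl⟩)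
    exact DFunLike.congr_fun h0 ⟨y, hy⟩
  · obtain ⟨μ, j⟩ := i
    rw [HilbertBasis.coe_mkOfOrthogonalEqBot]
    have hv : T (b μ j : H) = μ • (b μ j : H) := Module.End.mem_eigenspace_iff.1 (b μ j).2
    have hne : (b μ j : H) ≠ 0 := by
      simpa using (b μ).orthonormal.ne_zero j
    have hreal := hs.conj_eigenvalue_eq_self
      (Module.End.hasEigenvalue_of_hasEigenvector ⟨(b μ j).2, hne⟩)
    have hre : ((μ.re : ℝ) : ℂ) = μ := Complex.conj_eq_iff_re.1 hreal
    change T (b μ j : H) = ((μ.re : ℝ) : ℂ) • (b μ j : H)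
    rw [hre, hv]

section

variable {H : Type*} [NormedAddCommGroup H] [InnerProductSpace ℂ H] [CompleteSpace H]

omit [CompleteSpace H] in
theorem mem_spectrum_of_apply_eq_smul {T : H →L[ℂ] H} {x : H} (hx : x ≠ 0) {l : ℝ}
    (h : T x = (l : ℂ) • x) : l ∈ spectrum ℝ T := by
  rw [spectrum.mem_iff]
  rintro ⟨u, hu⟩
  have h0 : (u : H →L[ℂ] H) x = 0 := by
    rw [hu, sub_apply, h, Algebra.algebraMap_eq_smul_one]
    simp
  apply hx
  have : ((↑u⁻¹ : H →L[ℂ] H) * (u : H →L[ℂ] H)) x = 0 := by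
    rw [mul_apply_eq_comp, h0, map_zero]
  simpa using this

/-- The functions `g` with `g(T) x = g(l) x` form a closed algebra containing the identity, so
Stone-Weierstrass gives all continuous functions. -/
theorem cfc_apply_of_apply_eq_smul {T : H →L[ℂ] H} (hT : IsSelfAdjoint T) {f : ℝ → ℝ}
    (hf : ContinuousOn f (spectrum ℝ T)) {x : H} {l : ℝ} (h : T x = (l : ℂ) • x) :
    cfc f T x = (f l : ℂ) • x := by
  by_cases hx : x = 0
  · simp [hx]
  have hl := mem_spectrum_of_apply_eq_smul hx h
  rw [cfc_apply f T]
  suffices ∀ g : C(spectrum ℝ T, ℝ), cfcHom hT g x = (g ⟨l, hl⟩ : ℂ) • x from this _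
  intro g
  induction g using ContinuousMap.induction_on_of_compact with
  | const r =>
    have : cfcHom hT (ContinuousMap.const _ r) = algebraMap ℝ (H →L[ℂ] H) r :=
      AlgHomClass.commutes (cfcHom hT) r
    rw [this, Algebra.algebraMap_eq_smul_one]
    simp
  | id => rw [cfcHom_id hT]; exact h
  | star_id =>
    rw [star_trivial, cfcHom_id hT]; exact h
  | add f g hf hg => simp [hf, hg, add_smul]
  | mul f g hf hg =>
    rw [map_mul, mul_apply_eq_comp, hg, map_smul, hf, smul_smul]
    simp [mul_comm]
  | frequently f hf =>
    have hcl : IsClosed {g : C(spectrum ℝ T, ℝ) | cfcHom hT g x = (g ⟨l, hl⟩ : ℂ) • x} := by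
      refine isClosed_eq ?_ ?_
      · exact (ContinuousLinearMap.apply ℂ H x).continuous.comp (cfcHom_continuous hT)
      · have : Continuous fun g : C(spectrum ℝ T, ℝ) => g ⟨l, hl⟩ := by fun_prop
        fun_prop
    exact hcl.closure_subset (mem_closure_iff_frequently.2 hf)

theorem rpow_apply_of_apply_eq_smul {T : H →L[ℂ] H} (hT : 0 ≤ T) {r : ℝ} (hr : 0 ≤ r ∨ IsUnit T)
    {x : H} {l : ℝ} (h : T x = (l : ℂ) • x) : (T ^ r) x = ((l ^ r : ℝ) : ℂ) • x := by
  rw [CFC.rpow_eq_cfc_real (ha := hT)]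
  refine cfc_apply_of_apply_eq_smul (f := fun t => t ^ r) hT.isSelfAdjoint ?_ h
  intro t ht
  refine (Real.continuousAt_rpow_const t r ?_).continuousWithinAt
  rcases hr with hr | hr
  · exact Or.inr hr
  · left
    rintro rfl
    exact spectrum.zero_notMem ℝ hr ht

theorem rpow_mul_rpow_self {T : H →L[ℂ] H} (hT : 0 ≤ T) {r : ℝ} (hr : 0 ≤ r) :
    T ^ r * T ^ r = T ^ (r + r) := by
  simp only [CFC.rpow_eq_cfc_real (ha := hT)]
  rw [← cfc_mul (fun t : ℝ => t ^ r) (fun t : ℝ => t ^ r) T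
    ((Real.continuous_rpow_const hr).continuousOn) ((Real.continuous_rpow_const hr).continuousOn)]
  refine cfc_congr fun t ht => ?_
  exact (Real.rpow_add_of_nonneg (spectrum_nonneg_of_nonneg hT ht) hr hr).symm

/-- The square root is a norm limit of the operators `T (√T + ε)⁻¹`. -/
theorem isCompactOperator_sqrt {T : H →L[ℂ] H} (hT : 0 ≤ T) (hc : IsCompactOperator T) :
    IsCompactOperator (CFC.sqrt T : H →L[ℂ] H) := by
  have hsq : CFC.sqrt T = cfc Real.sqrt T := by
    rw [CFC.sqrt_eq_rpow, CFC.rpow_eq_cfc_real (ha := hT)]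
    exact cfc_congr fun t _ => (Real.sqrt_eq_rpow t).symm
  set g : ℕ → ℝ → ℝ := fun n t => (√t + 1 / ((n : ℝ) + 1))⁻¹ with hg
  have hpos : ∀ n : ℕ, (0 : ℝ) < 1 / ((n : ℝ) + 1) := fun n => by positivity
  have hne : ∀ n : ℕ, ∀ t : ℝ, √t + 1 / ((n : ℝ) + 1) ≠ 0 := fun n t =>
    (add_pos_of_nonneg_of_pos (Real.sqrt_nonneg t) (hpos n)).ne'
  have hgc : ∀ n, Continuous (g n) := fun n =>
    (Real.continuous_sqrt.add continuous_const).inv₀ (hne n)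
  refine isCompactOperator_of_tendsto (l := atTop) (F := fun n => T * cfc (g n) T) ?_
    (Eventually.of_forall fun n => ?_)
  · rw [tendsto_iff_norm_sub_tendsto_zero]
    refine squeeze_zero (fun _ => norm_nonneg _) (fun n => ?_)
      (tendsto_one_div_add_atTop_nhds_zero_nat (𝕜 := ℝ))
    have h1 : T * cfc (g n) T = cfc (fun t => t * g n t) T := by
      rw [cfc_mul (fun t => t) (g n) T continuousOn_id (hgc n).continuousOn]
      simp [cfc_id' ℝ T hT.isSelfAdjoint]
    rw [h1, hsq, ← cfc_sub (fun t => t * g n t) Real.sqrt T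
      ((continuous_id.mul (hgc n)).continuousOn) Real.continuous_sqrt.continuousOn]
    refine norm_cfc_le (hpos n).le fun t ht => ?_
    have ht0 : 0 ≤ t := spectrum_nonneg_of_nonneg hT ht
    have hs := Real.sqrt_nonneg t
    have hp := add_pos_of_nonneg_of_pos hs (hpos n)
    have h2 : t * g n t - √t = -((1 / ((n : ℝ) + 1)) * (√t / (√t + 1 / ((n : ℝ) + 1)))) := by
      simp only [hg]
      have : t = √t * √t := (Real.mul_self_sqrt ht0).symm
      have hne' := hp.ne'
      generalize 1 / ((n : ℝ) + 1) = c at *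
      rw [← div_eq_mul_inv, eq_comm, eq_sub_iff_add_eq, eq_div_iff hne']
      rw [add_mul, neg_mul, mul_assoc, div_mul_cancel₀ _ hne', ← sub_eq_zero]
      linear_combination -this
    rw [h2, norm_neg, norm_mul, Real.norm_of_nonneg (hpos n).le,
      Real.norm_of_nonneg (div_nonneg hs hp.le)]
    exact mul_le_of_le_one_right (hpos n).le
      ((div_le_one hp).2 (le_add_of_nonneg_right (hpos n).le))
  · exact hc.comp_clm (cfc (g n) T)

end

/-! ### Quadratic forms and traces -/

section

variable {H : Type*} [NormedAddCommGroup H] [InnerProductSpace ℂ H]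

/-- The value `⟪x, T x⟫` of the quadratic form of a positive operator `T`, in `[0, ∞]`. -/
noncomputable def quad (T : H →L[ℂ] H) (x : H) : ℝ≥0∞ :=
  ENNReal.ofReal (RCLike.re ⟪x, T x⟫_ℂ)

theorem re_inner_apply_nonneg {T : H →L[ℂ] H} (hT : 0 ≤ T) (x : H) :
    0 ≤ RCLike.re ⟪x, T x⟫_ℂ :=
  ((ContinuousLinearMap.nonneg_iff_isPositive T).1 hT).re_inner_nonneg_right x

theorem re_inner_apply_mono {S T : H →L[ℂ] H} (h : S ≤ T) (x : H) :
    RCLike.re ⟪x, S x⟫_ℂ ≤ RCLike.re ⟪x, T x⟫_ℂ := by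
  have := ((ContinuousLinearMap.le_def S T).1 h).re_inner_nonneg_right x
  rw [sub_apply, inner_sub_right, map_sub] at this
  linarith

theorem quad_mono {S T : H →L[ℂ] H} (h : S ≤ T) (x : H) : quad S x ≤ quad T x :=
  ENNReal.ofReal_le_ofReal (re_inner_apply_mono h x)

theorem quad_add {S T : H →L[ℂ] H} (hS : 0 ≤ S) (hT : 0 ≤ T) (x : H) :
    quad (S + T) x = quad S x + quad T x := by
  unfold quad
  rw [add_apply, inner_add_right, map_add,
    ENNReal.ofReal_add (re_inner_apply_nonneg hS x) (re_inner_apply_nonneg hT x)]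

theorem quad_of_apply_eq_smul {T : H →L[ℂ] H} {x : H} (hx : ‖x‖ = 1) {l : ℝ}
    (h : T x = (l : ℂ) • x) : quad T x = ENNReal.ofReal l := by
  unfold quad
  rw [h, inner_smul_right, inner_self_eq_norm_sq_to_K, hx]
  simp

theorem nonneg_of_apply_eq_smul {T : H →L[ℂ] H} (hT : 0 ≤ T) {x : H} (hx : ‖x‖ = 1) {l : ℝ}
    (h : T x = (l : ℂ) • x) : 0 ≤ l := by
  have := re_inner_apply_nonneg hT x
  rw [h, inner_smul_right, inner_self_eq_norm_sq_to_K, hx] at this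
  simpa using this

theorem quad_smul (T : H →L[ℂ] H) (c : ℝ) (x : H) :
    quad T ((c : ℂ) • x) = ENNReal.ofReal (c ^ 2) * quad T x := by
  unfold quad
  rw [← ENNReal.ofReal_mul (sq_nonneg c), map_smul, inner_smul_left, inner_smul_right,
    Complex.conj_ofReal, ← mul_assoc, ← Complex.ofReal_mul, ← sq]
  congr 1
  exact Complex.re_ofReal_mul _ _

variable [CompleteSpace H]

theorem quad_star_mul_self (T : H →L[ℂ] H) (x : H) :
    quad (star T * T) x = ENNReal.ofReal (‖T x‖ ^ 2) := by
  unfold quad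
  rw [mul_apply_eq_comp, ContinuousLinearMap.star_eq_adjoint,
    ContinuousLinearMap.adjoint_inner_right, inner_self_eq_norm_sq]

theorem quad_conj {S : H →L[ℂ] H} (hS : IsSelfAdjoint S) (T : H →L[ℂ] H) (x : H) :
    quad (S * T * S) x = quad T (S x) := by
  unfold quad
  rw [mul_apply_eq_comp, mul_apply_eq_comp, ← ContinuousLinearMap.adjoint_inner_left,
    ← ContinuousLinearMap.star_eq_adjoint, hS.star_eq]

theorem trace_eq_tsum_quad {ι : Type*} (e : HilbertBasis ι ℂ H) {T : H →L[ℂ] H} (hT : 0 ≤ T) :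
    trace T = ∑' i, quad T (e i) :=
  (traceAlong_eq_trace e hT).symm

theorem trace_add {S T : H →L[ℂ] H} (hS : 0 ≤ S) (hT : 0 ≤ T) :
    trace (S + T) = trace S + trace T := by
  obtain ⟨w, e, -⟩ := exists_hilbertBasis ℂ H
  rw [trace_eq_tsum_quad e (add_nonneg hS hT), trace_eq_tsum_quad e hS, trace_eq_tsum_quad e hT,
    ← ENNReal.tsum_add]
  simp only [quad_add hS hT]

/-- Both sides are the sum of the squared absolute values of the matrix entries of `T`. -/
theorem trace_star_mul_comm (T : H →L[ℂ] H) : trace (star T * T) = trace (T * star T) := by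
  obtain ⟨w, e, -⟩ := exists_hilbertBasis ℂ H
  have h2 : T * star T = star (star T) * star T := by rw [star_star]
  rw [h2, trace_eq_tsum_quad e (star_mul_self_nonneg T),
    trace_eq_tsum_quad e (star_mul_self_nonneg (star T))]
  simp only [quad_star_mul_self, ← tsum_inner_sq e]
  rw [ENNReal.tsum_comm]
  congr! 6 with j i
  rw [ContinuousLinearMap.star_eq_adjoint, ContinuousLinearMap.adjoint_inner_right,
    ← inner_conj_symm, RCLike.norm_conj]

/-- Tangent line inequality for `t ↦ t ^ q`. -/
theorem rpow_tangent_le {q s t : ℝ} (hq : 1 ≤ q) (hs : 0 < s) (ht : 0 ≤ t) :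
    q * s ^ (q - 1) * t + (1 - q) * s ^ q ≤ t ^ q := by
  have h := one_add_mul_self_le_rpow_one_add (s := t / s - 1) (by
    have := div_nonneg ht hs.le
    linarith) hq
  rw [add_sub_cancel, Real.div_rpow ht hs.le, le_div_iff₀ (Real.rpow_pos_of_pos hs q)] at h
  refine le_trans (le_of_eq ?_) h
  rw [Real.rpow_sub_one hs.ne']
  field_simp
  ring

/-- Jensen's inequality for the spectral measure of `T` at a unit vector. -/
theorem quad_rpow_le {T : H →L[ℂ] H} (hT : 0 ≤ T) {q : ℝ} (hq : 1 ≤ q) {x : H} (hx : ‖x‖ = 1) :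
    quad T x ^ q ≤ quad (T ^ q) x := by
  have hq0 : 0 ≤ q := zero_le_one.trans hq
  obtain ⟨s, hs⟩ : ∃ s, s = RCLike.re ⟪x, T x⟫_ℂ := ⟨_, rfl⟩
  rcases (re_inner_apply_nonneg hT x).eq_or_lt with h0 | h0
  · have : quad T x = 0 := by simp [quad, ← h0]
    rw [this, ENNReal.zero_rpow_of_pos (by linarith)]
    exact zero_le
  unfold quad
  rw [← hs] at h0 ⊢
  rw [ENNReal.ofReal_rpow_of_nonneg h0.le hq0]
  refine ENNReal.ofReal_le_ofReal ?_
  -- `T ^ q` lies above the tangent of the power function at `s = ⟪x, T x⟫`, evaluated at `T`.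
  have hcfc : cfc (fun t : ℝ => q * s ^ (q - 1) * t + (1 - q) * s ^ q) T ≤ T ^ q := by
    rw [CFC.rpow_eq_cfc_real (ha := hT)]
    refine cfc_mono (fun t ht => ?_) (by fun_prop)
      (Real.continuous_rpow_const hq0).continuousOn
    exact rpow_tangent_le hq h0 (spectrum_nonneg_of_nonneg hT ht)
  have haff : cfc (fun t : ℝ => q * s ^ (q - 1) * t + (1 - q) * s ^ q) T =
      (q * s ^ (q - 1)) • T + ((1 - q) * s ^ q) • 1 := by
    have hsa := hT.isSelfAdjoint
    rw [cfc_add_const _ (fun t : ℝ => q * s ^ (q - 1) * t) T (by fun_prop),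
      cfc_const_mul_id (q * s ^ (q - 1)) T, Algebra.algebraMap_eq_smul_one]
  refine le_trans (le_of_eq ?_) (re_inner_apply_mono hcfc x)
  rw [haff, add_apply, smul_apply, smul_apply, one_apply_eq_self, inner_add_right,
    inner_smul_right_eq_smul, inner_smul_right_eq_smul, map_add, inner_self_eq_norm_sq_to_K, hx]
  simp only [RCLike.real_smul_eq_coe_mul, RCLike.re_ofReal_mul, ← hs]
  rw [Real.rpow_sub_one h0.ne']
  simp only [map_one, one_pow, RCLike.one_re]
  field_simp
  ring

theorem quad_rpow_le_rpow_quad {T : H →L[ℂ] H} (hT : 0 ≤ T) {q : ℝ} (hq0 : 0 < q) (hq : q ≤ 1)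
    {x : H} (hx : ‖x‖ = 1) : quad (T ^ q) x ≤ quad T x ^ q := by
  have h := quad_rpow_le (T := T ^ q) CFC.rpow_nonneg (one_le_inv_iff₀.2 ⟨hq0, hq⟩) hx
  rw [CFC.rpow_rpow_of_exponent_nonneg T q q⁻¹ hq0.le (inv_pos.2 hq0).le hT,
    mul_inv_cancel₀ hq0.ne', CFC.rpow_one T hT] at h
  exact (ENNReal.rpow_inv_le_iff hq0).1 h

end

/-! ### Minkowski's inequalities for sequences -/

theorem tsum_Lp_add_le {ι : Type*} (f g : ι → ℝ≥0∞) {q : ℝ} (hq : 1 ≤ q) :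
    (∑' i, (f i + g i) ^ q) ^ (1 / q) ≤
      (∑' i, f i ^ q) ^ (1 / q) + (∑' i, g i ^ q) ^ (1 / q) := by
  have hq0 : 0 ≤ 1 / q := by positivity
  refine le_of_tendsto ((ENNReal.summable.hasSum).ennrpow_const (1 / q))
    (Eventually.of_forall fun s => ?_)
  refine (ENNReal.Lp_add_le s f g hq).trans ?_
  gcongr <;> exact ENNReal.sum_le_tsum s

/-- For `q ≤ 1` Minkowski's inequality is reversed. It is the triangle inequality of the norm
`(a, b) ↦ (a ^ (1 / q) + b ^ (1 / q)) ^ q` for the sum of the vectors `(f i ^ q, g i ^ q)`. -/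
theorem tsum_Lp_add_ge {ι : Type*} (f g : ι → ℝ≥0∞) {q : ℝ} (hq0 : 0 < q) (hq : q ≤ 1) :
    (∑' i, f i ^ q) ^ (1 / q) + (∑' i, g i ^ q) ^ (1 / q) ≤
      (∑' i, (f i + g i) ^ q) ^ (1 / q) := by
  have hr : 1 ≤ 1 / q := by rw [one_div]; exact one_le_inv_iff₀.2 ⟨hq0, hq⟩
  have key : ∀ s : Finset ι, ((∑ i ∈ s, f i ^ q) ^ (1 / q) + (∑ i ∈ s, g i ^ q) ^ (1 / q)) ^ q ≤
      ∑ i ∈ s, (f i + g i) ^ q := by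
    classical
    intro s
    induction s using Finset.induction_on with
    | empty => simp [hq0]
    | insert a s ha ih =>
      rw [Finset.sum_insert ha, Finset.sum_insert ha, Finset.sum_insert ha]
      -- The two-dimensional triangle inequality splits off the vector of index `a`.
      have h := ENNReal.Lp_add_le Finset.univ ![f a ^ q, g a ^ q]
        ![∑ i ∈ s, f i ^ q, ∑ i ∈ s, g i ^ q] hr
      simp only [Fin.sum_univ_two, Matrix.cons_val_zero, Matrix.cons_val_one] at h
      rw [one_div_one_div, ← ENNReal.rpow_mul, ← ENNReal.rpow_mul, mul_one_div_cancel hq0.ne',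
        ENNReal.rpow_one, ENNReal.rpow_one] at h
      exact h.trans (by gcongr)
  have hlim := (((ENNReal.summable (f := fun i => f i ^ q)).hasSum.ennrpow_const (1 / q)).add
    ((ENNReal.summable (f := fun i => g i ^ q)).hasSum.ennrpow_const (1 / q)))
  refine le_of_tendsto hlim (Eventually.of_forall fun s => ?_)
  rw [one_div, ENNReal.le_rpow_inv_iff hq0, ← one_div]
  exact (key s).trans (ENNReal.sum_le_tsum s)

theorem mul_rpow_sub_one (a : ℝ≥0∞) {q : ℝ} (hq : 1 ≤ q) : a * a ^ (q - 1) = a ^ q := by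
  have h := ENNReal.rpow_add_of_nonneg (x := a) 1 (q - 1) zero_le_one (sub_nonneg.2 hq)
  rw [add_sub_cancel, ENNReal.rpow_one] at h
  exact h.symm

/-! ### Traces of powers of positive compact operators -/

variable {H : Type*} [NormedAddCommGroup H] [InnerProductSpace ℂ H] [CompleteSpace H]

theorem trace_rpow_eq_tsum {ι : Type*} {T : H →L[ℂ] H} (hT : 0 ≤ T) {e : HilbertBasis ι ℂ H}
    {l : ι → ℝ} (h : IsEigenbasis T e l) {q : ℝ} (hq : 0 ≤ q) :
    trace (T ^ q) = ∑' i, quad T (e i) ^ q := by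
  rw [trace_eq_tsum_quad e CFC.rpow_nonneg]
  congr! 2 with i
  have h1 := e.orthonormal.1 i
  rw [quad_of_apply_eq_smul h1 (h i),
    quad_of_apply_eq_smul h1 (rpow_apply_of_apply_eq_smul hT (Or.inl hq) (h i)),
    ENNReal.ofReal_rpow_of_nonneg (nonneg_of_apply_eq_smul hT h1 (h i)) hq]

theorem tsum_quad_rpow_le_trace {ι : Type*} (e : HilbertBasis ι ℂ H) {T : H →L[ℂ] H} (hT : 0 ≤ T)
    {q : ℝ} (hq : 1 ≤ q) : ∑' i, quad T (e i) ^ q ≤ trace (T ^ q) := by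
  rw [trace_eq_tsum_quad e CFC.rpow_nonneg]
  exact ENNReal.tsum_le_tsum fun i => quad_rpow_le hT hq (e.orthonormal.1 i)

theorem trace_le_tsum_quad_rpow {ι : Type*} (e : HilbertBasis ι ℂ H) {T : H →L[ℂ] H} (hT : 0 ≤ T)
    {q : ℝ} (hq0 : 0 < q) (hq : q ≤ 1) : trace (T ^ q) ≤ ∑' i, quad T (e i) ^ q := by
  rw [trace_eq_tsum_quad e CFC.rpow_nonneg]
  exact ENNReal.tsum_le_tsum fun i => quad_rpow_le_rpow_quad hT hq0 hq (e.orthonormal.1 i)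

/-- The triangle inequality for the Schatten norm of positive compact operators: expand the trace
in an eigenbasis of the sum. -/
theorem trace_rpow_add_le {S T : H →L[ℂ] H} (hS : 0 ≤ S) (hT : 0 ≤ T)
    (hSc : IsCompactOperator S) (hTc : IsCompactOperator T) {q : ℝ} (hq : 1 ≤ q) :
    trace ((S + T) ^ q) ^ (1 / q) ≤ trace (S ^ q) ^ (1 / q) + trace (T ^ q) ^ (1 / q) := by
  have hST := add_nonneg hS hT
  obtain ⟨ι, e, l, h⟩ := exists_isEigenbasis hST.isSelfAdjoint (hSc.add hTc)
  rw [trace_rpow_eq_tsum hST h (zero_le_one.trans hq)]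
  simp only [quad_add hS hT]
  refine (tsum_Lp_add_le _ _ hq).trans ?_
  gcongr <;> exact tsum_quad_rpow_le_trace e ‹_› hq

/-- The reverse triangle inequality for positive compact operators. -/
theorem trace_rpow_add_ge {S T : H →L[ℂ] H} (hS : 0 ≤ S) (hT : 0 ≤ T)
    (hSc : IsCompactOperator S) (hTc : IsCompactOperator T) {q : ℝ} (hq0 : 0 < q) (hq : q ≤ 1) :
    trace (S ^ q) ^ (1 / q) + trace (T ^ q) ^ (1 / q) ≤ trace ((S + T) ^ q) ^ (1 / q) := by
  have hST := add_nonneg hS hT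
  obtain ⟨ι, e, l, h⟩ := exists_isEigenbasis hST.isSelfAdjoint (hSc.add hTc)
  rw [trace_rpow_eq_tsum hST h hq0.le]
  simp only [quad_add hS hT]
  refine le_trans ?_ (tsum_Lp_add_ge _ _ hq0 hq)
  gcongr <;> exact trace_le_tsum_quad_rpow e ‹_› hq0 hq

theorem trace_smul_rpow {T : H →L[ℂ] H} (hT : 0 ≤ T) (hTc : IsCompactOperator T) (n : ℕ) {q : ℝ}
    (hq : 0 ≤ q) : trace ((n • T) ^ q) = (n : ℝ≥0∞) ^ q * trace (T ^ q) := by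
  obtain ⟨ι, e, l, h⟩ := exists_isEigenbasis hT.isSelfAdjoint hTc
  have h' : IsEigenbasis (n • T) e fun i => n * l i := fun i => by
    rw [smul_apply, h i, ← Nat.cast_smul_eq_nsmul ℂ, smul_smul]
    push_cast
    rfl
  rw [trace_rpow_eq_tsum (nsmul_nonneg hT n) h' hq, trace_rpow_eq_tsum hT h hq,
    ← ENNReal.tsum_mul_left]
  congr! 2 with i
  have h1 := e.orthonormal.1 i
  rw [quad_of_apply_eq_smul h1 (h i), quad_of_apply_eq_smul h1 (h' i),
    ENNReal.ofReal_mul (Nat.cast_nonneg n), ENNReal.ofReal_natCast,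
    ENNReal.mul_rpow_of_nonneg _ _ hq]

/-- The trace of `S T S` in an eigenbasis of `T`: by `trace_star_mul_comm` it equals that of
`√T S² √T`. -/
theorem trace_conj_eq_tsum {ι : Type*} {S T : H →L[ℂ] H} (hS : IsSelfAdjoint S) (hT : 0 ≤ T)
    {e : HilbertBasis ι ℂ H} {l : ι → ℝ} (h : IsEigenbasis T e l) :
    trace (S * T * S) = ∑' i, ENNReal.ofReal (l i) * quad (S * S) (e i) := by
  set R := T ^ (1 / 2 : ℝ) with hR
  have hRs : IsSelfAdjoint R := (CFC.rpow_nonneg (a := T)).isSelfAdjoint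
  have hRR : R * R = T := by
    rw [hR, rpow_mul_rpow_self hT (by norm_num), add_halves, CFC.rpow_one T hT]
  have h1 : S * T * S = star (R * S) * (R * S) := by
    rw [star_mul, hS.star_eq, hRs.star_eq, ← hRR]
    simp only [mul_assoc]
  have h2 : (R * S) * star (R * S) = R * (S * S) * R := by
    rw [star_mul, hS.star_eq, hRs.star_eq]
    simp only [mul_assoc]
  rw [h1, trace_star_mul_comm, trace_eq_tsum_quad e (mul_star_self_nonneg _), h2]
  congr! 2 with i
  have hl := nonneg_of_apply_eq_smul hT (e.orthonormal.1 i) (h i)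
  rw [quad_conj hRs, hR, rpow_apply_of_apply_eq_smul hT (Or.inl (by norm_num)) (h i), quad_smul,
    ← Real.rpow_natCast, ← Real.rpow_mul hl]
  norm_num

/-- Both Jensen's inequality (for `1 ≤ r`) and operator monotonicity of powers (for `r ≤ 1`) show
that `⟪x, T ^ r x⟫` dominates the power of the eigenvalue of a smaller operator. -/
theorem ofReal_rpow_le_quad_rpow {S T : H →L[ℂ] H} (hS : 0 ≤ S) (hST : S ≤ T) {x : H}
    (hx : ‖x‖ = 1) {l : ℝ} (h : S x = (l : ℂ) • x) {r : ℝ} (hr : 0 ≤ r) :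
    ENNReal.ofReal l ^ r ≤ quad (T ^ r) x := by
  rcases le_total r 1 with hr1 | hr1
  · refine le_trans (le_of_eq ?_) (quad_mono (CFC.rpow_le_rpow ⟨hr, hr1⟩ hST) x)
    rw [quad_of_apply_eq_smul hx (rpow_apply_of_apply_eq_smul hS (Or.inl hr) h),
      ENNReal.ofReal_rpow_of_nonneg (nonneg_of_apply_eq_smul hS hx h) hr]
  · refine le_trans ?_ (quad_rpow_le (hS.trans hST) hr1 hx)
    rw [← quad_of_apply_eq_smul hx h]
    exact ENNReal.rpow_le_rpow (quad_mono hST x) hr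

/-- The comparison of `tr (S ^ q)` with one summand of `tr (R (S + T) R)` in McCarthy's inequality,
with `T` here in place of `S + T`. -/
theorem trace_rpow_le_trace_conj {S T : H →L[ℂ] H} (hS : 0 ≤ S) (hSc : IsCompactOperator S)
    (hST : S ≤ T) {q : ℝ} (hq : 1 ≤ q) :
    trace (S ^ q) ≤ trace (T ^ ((q - 1) / 2) * S * T ^ ((q - 1) / 2)) := by
  obtain ⟨ι, e, l, h⟩ := exists_isEigenbasis hS.isSelfAdjoint hSc
  rw [trace_rpow_eq_tsum hS h (zero_le_one.trans hq),
    trace_conj_eq_tsum (CFC.rpow_nonneg (a := T)).isSelfAdjoint hS h,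
    rpow_mul_rpow_self (hS.trans hST) (by linarith), add_halves]
  refine ENNReal.tsum_le_tsum fun i => ?_
  have h1 := e.orthonormal.1 i
  rw [quad_of_apply_eq_smul h1 (h i)]
  refine le_trans (le_of_eq ?_) (mul_le_mul_right
    (ofReal_rpow_le_quad_rpow hS hST h1 (h i) (sub_nonneg.2 hq)) _)
  exact (mul_rpow_sub_one _ hq).symm

/-- McCarthy's inequality: `S ↦ tr (S ^ q)` is superadditive on positive compact operators for
`1 ≤ q`. With `R = (S + T) ^ ((q - 1) / 2)`, the trace of `(S + T) ^ q` is that of `R (S + T) R`. -/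
theorem trace_rpow_superadd {S T : H →L[ℂ] H} (hS : 0 ≤ S) (hT : 0 ≤ T)
    (hSc : IsCompactOperator S) (hTc : IsCompactOperator T) {q : ℝ} (hq : 1 ≤ q) :
    trace (S ^ q) + trace (T ^ q) ≤ trace ((S + T) ^ q) := by
  have hST := add_nonneg hS hT
  set R := (S + T) ^ ((q - 1) / 2) with hR
  have hRs : IsSelfAdjoint R := (CFC.rpow_nonneg (a := S + T)).isSelfAdjoint
  have hconj : trace ((S + T) ^ q) = trace (R * S * R) + trace (R * T * R) := by
    rw [← trace_add (hRs.conjugate_nonneg hS) (hRs.conjugate_nonneg hT), ← add_mul, ← mul_add]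
    obtain ⟨ι, e, l, h⟩ := exists_isEigenbasis hST.isSelfAdjoint (hSc.add hTc)
    rw [trace_rpow_eq_tsum hST h (zero_le_one.trans hq), trace_conj_eq_tsum hRs hST h, hR,
      rpow_mul_rpow_self hST (by linarith), add_halves]
    congr! 2 with i
    have h1 := e.orthonormal.1 i
    have hq1 := sub_nonneg.2 hq
    rw [quad_of_apply_eq_smul h1 (h i),
      quad_of_apply_eq_smul h1 (rpow_apply_of_apply_eq_smul hST (Or.inl hq1) (h i)),
      ← ENNReal.ofReal_rpow_of_nonneg (nonneg_of_apply_eq_smul hST h1 (h i)) hq1,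
      mul_rpow_sub_one _ hq]
  rw [hconj]
  gcongr
  · exact trace_rpow_le_trace_conj hS hSc (le_add_of_nonneg_right hT) hq
  · exact trace_rpow_le_trace_conj hT hTc (le_add_of_nonneg_left hS) hq

/-! ### Subadditivity of the trace of powers with exponent at most one -/

theorem rpow_le_rpow_of_nonpos {S T : H →L[ℂ] H} (hS : IsStrictlyPositive S) (hST : S ≤ T)
    {r : ℝ} (hr1 : -1 ≤ r) (hr0 : r ≤ 0) : T ^ r ≤ S ^ r := by
  have hT := hS.of_le hST
  rcases hr0.eq_or_lt with rfl | hr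
  · rw [CFC.rpow_zero T hT.nonneg, CFC.rpow_zero S hS.nonneg]
  · have h := CStarAlgebra.rpow_neg_one_le_rpow_neg_one
      (CFC.rpow_le_rpow (p := -r) ⟨by linarith, by linarith⟩ hST) (hS.rpow (y := -r))
    rwa [CFC.rpow_rpow T (-r) (-1) (by linarith) hT, CFC.rpow_rpow S (-r) (-1) (by linarith) hS,
      mul_neg_one, neg_neg] at h

theorem isStrictlyPositive_add_algebraMap {T : H →L[ℂ] H} (hT : 0 ≤ T) {ε : ℝ} (hε : 0 < ε) :
    IsStrictlyPositive (T + algebraMap ℝ (H →L[ℂ] H) ε) := by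
  refine IsStrictlyPositive.nonneg_add hT ?_
  rw [Algebra.algebraMap_eq_smul_one]
  exact IsStrictlyPositive.smul hε isStrictlyPositive_one

omit [CompleteSpace H] in
theorem add_algebraMap_apply {T : H →L[ℂ] H} {x : H} {l : ℝ} (h : T x = (l : ℂ) • x) (ε : ℝ) :
    (T + algebraMap ℝ (H →L[ℂ] H) ε) x = ((l + ε : ℝ) : ℂ) • x := by
  rw [add_apply, h, Algebra.algebraMap_eq_smul_one, Complex.ofReal_add, add_smul]
  simp

theorem rpow_half_mul_rpow_half {T : H →L[ℂ] H} (hT : IsUnit T) (r : ℝ) :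
    T ^ (r / 2) * T ^ (r / 2) = T ^ r := by
  rw [← CFC.rpow_add hT, add_halves]

/-- The counterpart of `trace_rpow_le_trace_conj` for `q ≤ 1`. The shift by `ε` makes the negative
power meaningful; the bound does not depend on it. -/
theorem trace_conj_le_trace_rpow {S T : H →L[ℂ] H} (hS : 0 ≤ S) (hSc : IsCompactOperator S)
    (hST : S ≤ T) {q : ℝ} (hq0 : 0 < q) (hq : q ≤ 1) {ε : ℝ} (hε : 0 < ε) :
    trace ((T + algebraMap ℝ (H →L[ℂ] H) ε) ^ ((q - 1) / 2) * S *
      (T + algebraMap ℝ (H →L[ℂ] H) ε) ^ ((q - 1) / 2)) ≤ trace (S ^ q) := by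
  have hSε := isStrictlyPositive_add_algebraMap hS hε
  obtain ⟨ι, e, l, h⟩ := exists_isEigenbasis hS.isSelfAdjoint hSc
  rw [trace_conj_eq_tsum CFC.rpow_nonneg.isSelfAdjoint hS h,
    rpow_half_mul_rpow_half (isStrictlyPositive_add_algebraMap (hS.trans hST) hε).isUnit,
    trace_rpow_eq_tsum hS h hq0.le]
  refine ENNReal.tsum_le_tsum fun i => ?_
  have h1 := e.orthonormal.1 i
  have hl := nonneg_of_apply_eq_smul hS h1 (h i)
  have hle := quad_mono (rpow_le_rpow_of_nonpos hSε (add_le_add_left hST _)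
    (show -1 ≤ q - 1 by linarith) (by linarith)) (e i)
  rw [quad_of_apply_eq_smul h1 (rpow_apply_of_apply_eq_smul hSε.nonneg (Or.inr hSε.isUnit)
    (add_algebraMap_apply (h i) ε))] at hle
  refine (mul_le_mul_right hle _).trans ?_
  rw [quad_of_apply_eq_smul h1 (h i), ← ENNReal.ofReal_mul hl,
    ENNReal.ofReal_rpow_of_nonneg hl hq0.le]
  refine ENNReal.ofReal_le_ofReal ?_
  rcases hl.eq_or_lt with h0 | h0
  · rw [← h0, zero_mul]
    exact Real.rpow_nonneg le_rfl q
  · calc l i * (l i + ε) ^ (q - 1) ≤ l i * l i ^ (q - 1) :=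
          mul_le_mul_of_nonneg_left
            (Real.rpow_le_rpow_of_nonpos h0 (by linarith) (by linarith)) hl
      _ = l i ^ q := by rw [Real.rpow_sub_one h0.ne', mul_div_cancel₀ _ h0.ne']

theorem tendsto_mul_add_rpow_sub_one {l q : ℝ} (hl : 0 ≤ l) (hq : 0 < q) :
    Tendsto (fun ε : ℝ => l * (l + ε) ^ (q - 1)) (𝓝[>] 0) (𝓝 (l ^ q)) := by
  rcases hl.eq_or_lt with rfl | h0
  · simp [Real.zero_rpow hq.ne']
  · have h : ContinuousAt (fun ε : ℝ => l * (l + ε) ^ (q - 1)) 0 := by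
      refine continuousAt_const.mul (ContinuousAt.rpow_const (by fun_prop) (Or.inl ?_))
      simpa using h0.ne'
    have h2 := h.tendsto
    simp only [add_zero] at h2
    rw [Real.rpow_sub_one h0.ne', mul_div_cancel₀ _ h0.ne'] at h2
    exact h2.mono_left nhdsWithin_le_nhds

/-- `S ↦ tr (S ^ q)` is subadditive on positive compact operators for `q ≤ 1`: with
`R = (S + T + ε) ^ ((q - 1) / 2)`, the trace of `R (S + T) R` tends to that of `(S + T) ^ q` as
`ε → 0`, while `tr (R S R) ≤ tr (S ^ q)` because powers in `[-1, 0]` are operator antitone. -/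
theorem trace_rpow_subadd {S T : H →L[ℂ] H} (hS : 0 ≤ S) (hT : 0 ≤ T)
    (hSc : IsCompactOperator S) (hTc : IsCompactOperator T) {q : ℝ} (hq0 : 0 < q) (hq : q ≤ 1) :
    trace ((S + T) ^ q) ≤ trace (S ^ q) + trace (T ^ q) := by
  have hST := add_nonneg hS hT
  obtain ⟨ι, e, l, h⟩ := exists_isEigenbasis hST.isSelfAdjoint (hSc.add hTc)
  have h1 := e.orthonormal.1
  have hl := fun i => nonneg_of_apply_eq_smul hST (h1 i) (h i)
  have key : ∀ ε : ℝ, 0 < ε → ∑' i, ENNReal.ofReal (l i * (l i + ε) ^ (q - 1)) ≤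
      trace (S ^ q) + trace (T ^ q) := by
    intro ε hε
    have hp := isStrictlyPositive_add_algebraMap hST hε
    set R := (S + T + algebraMap ℝ (H →L[ℂ] H) ε) ^ ((q - 1) / 2) with hR
    have hRs : IsSelfAdjoint R := CFC.rpow_nonneg.isSelfAdjoint
    calc ∑' i, ENNReal.ofReal (l i * (l i + ε) ^ (q - 1)) = trace (R * (S + T) * R) := by
          rw [trace_conj_eq_tsum hRs hST h, hR, rpow_half_mul_rpow_half hp.isUnit]
          congr! 2 with i
          rw [quad_of_apply_eq_smul (h1 i) (rpow_apply_of_apply_eq_smul hp.nonneg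
            (Or.inr hp.isUnit) (add_algebraMap_apply (h i) ε)), ENNReal.ofReal_mul (hl i)]
      _ = trace (R * S * R) + trace (R * T * R) := by
          rw [← trace_add (hRs.conjugate_nonneg hS) (hRs.conjugate_nonneg hT), mul_add, add_mul]
      _ ≤ trace (S ^ q) + trace (T ^ q) := add_le_add
          (trace_conj_le_trace_rpow hS hSc (le_add_of_nonneg_right hT) hq0 hq hε)
          (trace_conj_le_trace_rpow hT hTc (le_add_of_nonneg_left hS) hq0 hq hε)
  rw [trace_rpow_eq_tsum hST h hq0.le, ENNReal.tsum_eq_iSup_sum]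
  refine iSup_le fun s => ?_
  have hlim : Tendsto (fun ε : ℝ => ∑ i ∈ s, ENNReal.ofReal (l i * (l i + ε) ^ (q - 1))) (𝓝[>] 0)
      (𝓝 (∑ i ∈ s, quad (S + T) (e i) ^ q)) := by
    refine tendsto_finsetSum _ fun i _ => ?_
    rw [quad_of_apply_eq_smul (h1 i) (h i), ENNReal.ofReal_rpow_of_nonneg (hl i) hq0.le]
    exact ENNReal.tendsto_ofReal (tendsto_mul_add_rpow_sub_one (hl i) hq0)
  refine le_of_tendsto hlim ?_
  filter_upwards [self_mem_nhdsWithin] with ε hε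
  exact (ENNReal.sum_le_tsum s).trans (key ε hε)

/-! ### Finite sums of positive compact operators -/

/-- `T` is a positive compact operator. -/
def IsPosCompact (T : H →L[ℂ] H) : Prop :=
  0 ≤ T ∧ IsCompactOperator T

theorem IsPosCompact.add {S T : H →L[ℂ] H} (hS : IsPosCompact S) (hT : IsPosCompact T) :
    IsPosCompact (S + T) :=
  ⟨add_nonneg hS.1 hT.1, hS.2.add hT.2⟩

omit [CompleteSpace H] in
theorem isPosCompact_zero : IsPosCompact (0 : H →L[ℂ] H) :=
  ⟨le_rfl, isCompactOperator_zero⟩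

theorem isPosCompact_sum {ι : Type*} {s : Finset ι} {T : ι → H →L[ℂ] H}
    (hT : ∀ i ∈ s, IsPosCompact (T i)) : IsPosCompact (∑ i ∈ s, T i) :=
  Finset.sum_induction T IsPosCompact (fun _ _ => IsPosCompact.add) isPosCompact_zero hT

theorem isPosCompact_star_mul_self {A : H →L[ℂ] H} (hA : IsCompactOperator A) :
    IsPosCompact (star A * A) :=
  ⟨star_mul_self_nonneg A, hA.clm_comp (star A)⟩

/-- The Schatten (quasi-)norm `(tr (T ^ q)) ^ (1 / q)` of a positive operator, in `[0, ∞]`. -/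
noncomputable def posNorm (q : ℝ) (T : H →L[ℂ] H) : ℝ≥0∞ :=
  trace (T ^ q) ^ (1 / q)

theorem posNorm_rpow {q : ℝ} (hq : 0 < q) (T : H →L[ℂ] H) : posNorm q T ^ q = trace (T ^ q) := by
  rw [posNorm, ← ENNReal.rpow_mul, one_div_mul_cancel hq.ne', ENNReal.rpow_one]

theorem trace_zero_rpow {q : ℝ} (hq : 0 < q) : trace ((0 : H →L[ℂ] H) ^ q) = 0 := by
  rw [← CFC.rpow_eq_pow, CFC.zero_rpow hq.ne']
  simp [trace, traceAlong]

theorem posNorm_zero {q : ℝ} (hq : 0 < q) : posNorm q (0 : H →L[ℂ] H) = 0 := by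
  rw [posNorm, trace_zero_rpow hq, ENNReal.zero_rpow_of_pos (by positivity)]

theorem posNorm_add_le {S T : H →L[ℂ] H} (hS : IsPosCompact S) (hT : IsPosCompact T) {q : ℝ}
    (hq : 1 ≤ q) : posNorm q (S + T) ≤ posNorm q S + posNorm q T :=
  trace_rpow_add_le hS.1 hT.1 hS.2 hT.2 hq

theorem posNorm_add_ge {S T : H →L[ℂ] H} (hS : IsPosCompact S) (hT : IsPosCompact T) {q : ℝ}
    (hq0 : 0 < q) (hq : q ≤ 1) : posNorm q S + posNorm q T ≤ posNorm q (S + T) :=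
  trace_rpow_add_ge hS.1 hT.1 hS.2 hT.2 hq0 hq

theorem sum_le_of_superadditive {f : (H →L[ℂ] H) → ℝ≥0∞} (h0 : f 0 = 0)
    (hf : ∀ S T, IsPosCompact S → IsPosCompact T → f S + f T ≤ f (S + T))
    {ι : Type*} (s : Finset ι) {T : ι → H →L[ℂ] H} (hT : ∀ i, IsPosCompact (T i)) :
    ∑ i ∈ s, f (T i) ≤ f (∑ i ∈ s, T i) := by
  classical
  induction s using Finset.induction_on with
  | empty => simp [h0]
  | insert a s ha ih =>
    rw [Finset.sum_insert ha, Finset.sum_insert ha]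
    exact (add_le_add_right ih _).trans (hf _ _ (hT a) (isPosCompact_sum fun i _ => hT i))

theorem le_sum_of_subadditive {f : (H →L[ℂ] H) → ℝ≥0∞} (h0 : f 0 = 0)
    (hf : ∀ S T, IsPosCompact S → IsPosCompact T → f (S + T) ≤ f S + f T)
    {ι : Type*} (s : Finset ι) {T : ι → H →L[ℂ] H} (hT : ∀ i, IsPosCompact (T i)) :
    f (∑ i ∈ s, T i) ≤ ∑ i ∈ s, f (T i) := by
  classical
  induction s using Finset.induction_on with
  | empty => simp [h0]
  | insert a s ha ih =>
    rw [Finset.sum_insert ha, Finset.sum_insert ha]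
    exact (hf _ _ (hT a) (isPosCompact_sum fun i _ => hT i)).trans (add_le_add_right ih _)

theorem trace_sum_rpow {ι : Type*} [Fintype ι] {Y : ι → H →L[ℂ] H} (hY : ∀ i, IsPosCompact (Y i))
    {q : ℝ} (hq : 0 < q) :
    trace ((Fintype.card ι • ∑ i, Y i) ^ q) =
      (Fintype.card ι : ℝ≥0∞) ^ q * trace ((∑ i, Y i) ^ q) :=
  have h := isPosCompact_sum fun i (_ : i ∈ Finset.univ) => hY i
  trace_smul_rpow h.1 h.2 _ hq.le

/-- The inequality for exponents `q ≥ 1`: Minkowski's inequality for the `X k`, superadditivity of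
the trace of `q`-th powers for the `Y i`, and the power mean inequality. -/
theorem card_mul_sum_posNorm_le {ι κ : Type*} [Fintype ι] [Fintype κ] {X : κ → H →L[ℂ] H}
    {Y : ι → H →L[ℂ] H} (hX : ∀ k, IsPosCompact (X k)) (hY : ∀ i, IsPosCompact (Y i))
    (hXY : ∑ k, X k = Fintype.card ι • ∑ i, Y i) {q : ℝ} (hq : 1 ≤ q) :
    (Fintype.card ι : ℝ≥0∞) ^ (1 / q) * ∑ i, posNorm q (Y i) ≤ ∑ k, posNorm q (X k) := by
  have hq0 : 0 < q := zero_lt_one.trans_le hq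
  have hX' : posNorm q (∑ k, X k) ≤ ∑ k, posNorm q (X k) :=
    le_sum_of_subadditive (f := posNorm q) (posNorm_zero hq0)
      (fun _ _ hS hT => posNorm_add_le hS hT hq) _ hX
  have hY' : ∑ i, trace (Y i ^ q) ≤ trace ((∑ i, Y i) ^ q) :=
    sum_le_of_superadditive (f := fun T => trace (T ^ q)) (trace_zero_rpow hq0)
      (fun S T hS hT => trace_rpow_superadd hS.1 hT.1 hS.2 hT.2 hq) _ hY
  refine (ENNReal.rpow_le_rpow_iff hq0).1 (le_trans ?_ (ENNReal.rpow_le_rpow hX' hq0.le))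
  rw [posNorm_rpow hq0, hXY, trace_sum_rpow hY hq0, ENNReal.mul_rpow_of_nonneg _ _ hq0.le,
    ← ENNReal.rpow_mul, one_div_mul_cancel hq0.ne', ENNReal.rpow_one,
    ← mul_rpow_sub_one (Fintype.card ι : ℝ≥0∞) hq, mul_assoc]
  refine mul_le_mul_right ((ENNReal.rpow_sum_le_const_mul_sum_rpow _ _ hq).trans ?_) _
  simp only [posNorm_rpow hq0, Finset.card_univ]
  exact mul_le_mul_right hY' _

/-- The inequality for exponents `q ≤ 1`, where each of the three inequalities is reversed. -/
theorem sum_posNorm_le_card_mul {ι κ : Type*} [Fintype ι] [Fintype κ] {X : κ → H →L[ℂ] H}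
    {Y : ι → H →L[ℂ] H} (hX : ∀ k, IsPosCompact (X k)) (hY : ∀ i, IsPosCompact (Y i))
    (hXY : ∑ k, X k = Fintype.card ι • ∑ i, Y i) {q : ℝ} (hq0 : 0 < q) (hq : q ≤ 1) :
    ∑ k, posNorm q (X k) ≤ (Fintype.card ι : ℝ≥0∞) ^ (1 / q) * ∑ i, posNorm q (Y i) := by
  have hr : 1 ≤ 1 / q := by rw [one_div]; exact one_le_inv_iff₀.2 ⟨hq0, hq⟩
  have hX' : ∑ k, posNorm q (X k) ≤ posNorm q (∑ k, X k) :=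
    sum_le_of_superadditive (f := posNorm q) (posNorm_zero hq0)
      (fun _ _ hS hT => posNorm_add_ge hS hT hq0 hq) _ hX
  have hY' : trace ((∑ i, Y i) ^ q) ≤ ∑ i, trace (Y i ^ q) :=
    le_sum_of_subadditive (f := fun T => trace (T ^ q)) (trace_zero_rpow hq0)
      (fun S T hS hT => trace_rpow_subadd hS.1 hT.1 hS.2 hT.2 hq0 hq) _ hY
  refine hX'.trans ?_
  rw [posNorm, hXY, trace_sum_rpow hY hq0, ENNReal.mul_rpow_of_nonneg _ _ (one_div_pos.2 hq0).le,
    ← ENNReal.rpow_mul, mul_one_div_cancel hq0.ne', ENNReal.rpow_one,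
    ← mul_rpow_sub_one (Fintype.card ι : ℝ≥0∞) hr,
    mul_assoc]
  refine mul_le_mul_right ((ENNReal.rpow_le_rpow hY' (one_div_pos.2 hq0).le).trans ?_) _
  exact ENNReal.rpow_sum_le_const_mul_sum_rpow _ _ hr

theorem posNorm_mono_add {S T : H →L[ℂ] H} (hS : IsPosCompact S) (hT : IsPosCompact T) {q : ℝ}
    (hq0 : 0 < q) : posNorm q S ≤ posNorm q (S + T) := by
  rcases le_total q 1 with hq | hq
  · exact le_self_add.trans (posNorm_add_ge hS hT hq0 hq)
  · exact ENNReal.rpow_le_rpow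
      (le_self_add.trans (trace_rpow_superadd hS.1 hT.1 hS.2 hT.2 hq)) (by positivity)

theorem posNorm_lt_top_iff {T : H →L[ℂ] H} {q : ℝ} (hq : 0 < q) :
    posNorm q T < ∞ ↔ trace (T ^ q) < ∞ :=
  ENNReal.rpow_lt_top_iff_of_pos (one_div_pos.2 hq)

theorem posNorm_add_lt_top {S T : H →L[ℂ] H} (hS : IsPosCompact S) (hT : IsPosCompact T) {q : ℝ}
    (hq0 : 0 < q) (hS' : posNorm q S < ∞) (hT' : posNorm q T < ∞) : posNorm q (S + T) < ∞ := by
  rcases le_total q 1 with hq | hq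
  · rw [posNorm_lt_top_iff hq0] at *
    exact (trace_rpow_subadd hS.1 hT.1 hS.2 hT.2 hq0 hq).trans_lt (ENNReal.add_lt_top.2 ⟨hS', hT'⟩)
  · exact (posNorm_add_le hS hT hq).trans_lt (ENNReal.add_lt_top.2 ⟨hS', hT'⟩)

/-! ### Schatten classes -/

theorem traceAbsPow_eq (A : H →L[ℂ] H) {p : ℝ} (hp : 0 < p) :
    traceAbsPow p A = trace ((star A * A) ^ (p / 2)) := by
  rw [traceAbsPow, CFC.abs, CFC.sqrt_eq_rpow, CFC.rpow_rpow_of_exponent_nonneg _ _ _ (by norm_num)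
    hp.le (star_mul_self_nonneg A), one_div_mul_eq_div]

theorem mem_schattenClass_iff (A : H →L[ℂ] H) {p : ℝ} (hp : 0 < p) :
    A ∈ schattenClass p H ↔ IsCompactOperator A ∧ posNorm (p / 2) (star A * A) < ∞ := by
  rw [posNorm_lt_top_iff (half_pos hp), ← traceAbsPow_eq A hp]
  rfl

theorem schattenNorm_sq (A : H →L[ℂ] H) {p : ℝ} (hp : 0 < p) :
    schattenNorm p A ^ 2 = (posNorm (p / 2) (star A * A)).toReal := by
  rw [schattenNorm, posNorm, traceAbsPow_eq A hp, ← ENNReal.toReal_rpow, ← Real.rpow_natCast,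
    ← Real.rpow_mul ENNReal.toReal_nonneg]
  congr 1
  push_cast
  field_simp

theorem sqrtSumAbsSq_eq (A B : H →L[ℂ] H) :
    sqrtSumAbsSq A B = CFC.sqrt (star A * A + star B * B) := by
  rw [sqrtSumAbsSq, CFC.abs_sq, CFC.abs_sq]

theorem star_sqrtSumAbsSq_mul_self (A B : H →L[ℂ] H) :
    star (sqrtSumAbsSq A B) * sqrtSumAbsSq A B = star A * A + star B * B := by
  rw [sqrtSumAbsSq_eq, (CFC.sqrt_nonneg _).isSelfAdjoint.star_eq, CFC.sqrt_mul_sqrt_self _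
    (add_nonneg (star_mul_self_nonneg A) (star_mul_self_nonneg B))]

theorem neg_mem_schattenClass {p : ℝ} {A : H →L[ℂ] H} (hA : A ∈ schattenClass p H) :
    -A ∈ schattenClass p H :=
  ⟨hA.1.neg, by rw [traceAbsPow, CFC.abs_neg]; exact hA.2⟩

theorem posNorm_sum_star_mul_self_lt_top {p : ℝ} (hp : 0 < p) {A B : H →L[ℂ] H}
    (hA : A ∈ schattenClass p H) (hB : B ∈ schattenClass p H) :
    posNorm (p / 2) (star A * A + star B * B) < ∞ :=
  posNorm_add_lt_top (isPosCompact_star_mul_self hA.1) (isPosCompact_star_mul_self hB.1)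
    (half_pos hp) ((mem_schattenClass_iff A hp).1 hA).2 ((mem_schattenClass_iff B hp).1 hB).2

theorem sqrtSumAbsSq_mem_schattenClass {p : ℝ} (hp : 0 < p) {A B : H →L[ℂ] H}
    (hA : A ∈ schattenClass p H) (hB : B ∈ schattenClass p H) :
    sqrtSumAbsSq A B ∈ schattenClass p H := by
  rw [mem_schattenClass_iff _ hp, star_sqrtSumAbsSq_mul_self]
  have h := (isPosCompact_star_mul_self hA.1).add (isPosCompact_star_mul_self hB.1)
  refine ⟨?_, posNorm_sum_star_mul_self_lt_top hp hA hB⟩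
  rw [sqrtSumAbsSq_eq]
  exact isCompactOperator_sqrt h.1 h.2

theorem add_mem_schattenClass {p : ℝ} (hp : 0 < p) {A B : H →L[ℂ] H}
    (hA : A ∈ schattenClass p H) (hB : B ∈ schattenClass p H) :
    A + B ∈ schattenClass p H := by
  have hc : IsCompactOperator (A + B : H →L[ℂ] H) := hA.1.add hB.1
  have hc' : IsCompactOperator (A - B : H →L[ℂ] H) := hA.1.sub hB.1
  refine (mem_schattenClass_iff _ hp).2 ⟨hc, ?_⟩
  -- The parallelogram identity bounds `|A + B|²` by `2 (|A|² + |B|²)`.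
  have hpar : star (A + B) * (A + B) + star (A - B) * (A - B) =
      (star A * A + star B * B) + (star A * A + star B * B) := by
    rw [star_add, star_sub]
    noncomm_ring
  have hs := (isPosCompact_star_mul_self hA.1).add (isPosCompact_star_mul_self hB.1)
  have hf := posNorm_sum_star_mul_self_lt_top hp hA hB
  refine (posNorm_mono_add (isPosCompact_star_mul_self hc) (isPosCompact_star_mul_self hc')
    (half_pos hp)).trans_lt ?_
  rw [hpar]
  exact posNorm_add_lt_top hs hs (half_pos hp) hf hf

/-- The mixed terms of `|A i + B j|²` sum to zero by hypothesis and its adjoint. -/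
theorem sum_star_add_mul_self {n : ℕ} {A B : Fin n → H →L[ℂ] H}
    (hAB : ∑ i, ∑ j, star (A i) * B j = 0) :
    ∑ k : Fin n × Fin n, star (A k.1 + B k.2) * (A k.1 + B k.2) =
      Fintype.card (Fin n) • ∑ i, (star (A i) * A i + star (B i) * B i) := by
  have hBA : ∑ i, ∑ j, star (B j) * A i = 0 := by
    simpa [star_sum] using congrArg star hAB
  rw [Fintype.sum_prod_type]
  simp only [star_add, add_mul, mul_add, Finset.sum_add_distrib, hAB, hBA]
  simp [Finset.smul_sum]

/-- Both inequalities for the operators `A i + B j`; those for `A i - B j` follow by applying it to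
`-B`. -/
theorem sum_schattenNorm_add_sq {n : ℕ} {p : ℝ} (hp : 0 < p) {A B : Fin n → H →L[ℂ] H}
    (hA : ∀ i, A i ∈ schattenClass p H) (hB : ∀ i, B i ∈ schattenClass p H)
    (hAB : ∑ i, ∑ j, star (A i) * B j = 0) :
    (p ≤ 2 → ∑ i, ∑ j, schattenNorm p (A i + B j) ^ 2 ≤
      (n : ℝ) ^ (2 / p) * ∑ i, schattenNorm p (sqrtSumAbsSq (A i) (B i)) ^ 2) ∧
    (2 ≤ p → (n : ℝ) ^ (2 / p) * ∑ i, schattenNorm p (sqrtSumAbsSq (A i) (B i)) ^ 2 ≤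
      ∑ i, ∑ j, schattenNorm p (A i + B j) ^ 2) := by
  have hsum := fun i j => add_mem_schattenClass hp (hA i) (hB j)
  set X : Fin n × Fin n → H →L[ℂ] H := fun k => star (A k.1 + B k.2) * (A k.1 + B k.2) with hXdef
  set Y : Fin n → H →L[ℂ] H := fun i => star (A i) * A i + star (B i) * B i with hYdef
  have hX : ∀ k, IsPosCompact (X k) := fun k => isPosCompact_star_mul_self (hsum k.1 k.2).1
  have hY : ∀ i, IsPosCompact (Y i) := fun i =>
    (isPosCompact_star_mul_self (hA i).1).add (isPosCompact_star_mul_self (hB i).1)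
  have hXf : ∑ k, posNorm (p / 2) (X k) ≠ ∞ := (ENNReal.sum_lt_top.2 fun k _ =>
    ((mem_schattenClass_iff _ hp).1 (hsum k.1 k.2)).2).ne
  have hYf : (n : ℝ≥0∞) ^ (1 / (p / 2)) * ∑ i, posNorm (p / 2) (Y i) ≠ ∞ :=
    ENNReal.mul_ne_top (ENNReal.rpow_ne_top_of_nonneg (by positivity) (ENNReal.natCast_ne_top n))
      (ENNReal.sum_lt_top.2 fun i _ => posNorm_sum_star_mul_self_lt_top hp (hA i) (hB i)).ne
  have hXr : ∑ i, ∑ j, schattenNorm p (A i + B j) ^ 2 = (∑ k, posNorm (p / 2) (X k)).toReal := by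
    rw [ENNReal.toReal_sum fun k _ => ((mem_schattenClass_iff _ hp).1 (hsum k.1 k.2)).2.ne,
      Fintype.sum_prod_type]
    simp only [schattenNorm_sq _ hp, hXdef]
  have hYr : (n : ℝ) ^ (2 / p) * ∑ i, schattenNorm p (sqrtSumAbsSq (A i) (B i)) ^ 2 =
      ((n : ℝ≥0∞) ^ (1 / (p / 2)) * ∑ i, posNorm (p / 2) (Y i)).toReal := by
    rw [ENNReal.toReal_mul, ← ENNReal.toReal_rpow, ENNReal.toReal_natCast, one_div_div,
      ENNReal.toReal_sum fun i _ => (posNorm_sum_star_mul_self_lt_top hp (hA i) (hB i)).ne]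
    simp only [schattenNorm_sq _ hp, star_sqrtSumAbsSq_mul_self]
  have hXY := sum_star_add_mul_self hAB
  rw [hXr, hYr]
  constructor <;> intro hp2
  · refine ENNReal.toReal_mono hYf ?_
    simpa using sum_posNorm_le_card_mul hX hY hXY (half_pos hp) (by linarith)
  · refine ENNReal.toReal_mono hXf ?_
    simpa using card_mul_sum_posNorm_le hX hY hXY (q := p / 2) (by linarith)

end Schatten

theorem mainTheorem2 {H : Type*} [NormedAddCommGroup H] [InnerProductSpace ℂ H]
    [CompleteSpace H] [TopologicalSpace.SeparableSpace H]
    (n : ℕ) (p : ℝ) (hp : 0 < p) (A B : Fin n → H →L[ℂ] H)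
    (hA : ∀ i, A i ∈ Schatten.schattenClass p H)
    (hB : ∀ i, B i ∈ Schatten.schattenClass p H)
    (hAB : ∑ i, ∑ j, star (A i) * B j = 0) :
    (∀ i j, A i + B j ∈ Schatten.schattenClass p H ∧ A i - B j ∈ Schatten.schattenClass p H) ∧
    (∀ i, Schatten.sqrtSumAbsSq (A i) (B i) ∈ Schatten.schattenClass p H) ∧
    (p ≤ 2 →
      ∑ i, ∑ j, Schatten.schattenNorm p (A i + B j) ^ 2 ≤
        (n : ℝ) ^ (2 / p) *
          ∑ i, Schatten.schattenNorm p (Schatten.sqrtSumAbsSq (A i) (B i)) ^ 2 ∧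
      ∑ i, ∑ j, Schatten.schattenNorm p (A i - B j) ^ 2 ≤
        (n : ℝ) ^ (2 / p) *
          ∑ i, Schatten.schattenNorm p (Schatten.sqrtSumAbsSq (A i) (B i)) ^ 2) ∧
    (2 ≤ p →
      (n : ℝ) ^ (2 / p) *
          ∑ i, Schatten.schattenNorm p (Schatten.sqrtSumAbsSq (A i) (B i)) ^ 2 ≤
        ∑ i, ∑ j, Schatten.schattenNorm p (A i + B j) ^ 2 ∧
      (n : ℝ) ^ (2 / p) *
          ∑ i, Schatten.schattenNorm p (Schatten.sqrtSumAbsSq (A i) (B i)) ^ 2 ≤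
        ∑ i, ∑ j, Schatten.schattenNorm p (A i - B j) ^ 2) := by
  have hB' : ∀ i, -B i ∈ Schatten.schattenClass p H := fun i =>
    Schatten.neg_mem_schattenClass (hB i)
  have hplus := Schatten.sum_schattenNorm_add_sq hp hA hB hAB
  have hminus := Schatten.sum_schattenNorm_add_sq (B := fun i => -B i) hp hA hB' (by simp [hAB])
  simp only [Schatten.sqrtSumAbsSq, CFC.abs_neg, ← sub_eq_add_neg] at hminus
  refine ⟨fun i j => ⟨Schatten.add_mem_schattenClass hp (hA i) (hB j), ?_⟩,
    fun i => Schatten.sqrtSumAbsSq_mem_schattenClass hp (hA i) (hB i),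
    fun h => ⟨hplus.1 h, hminus.1 h⟩, fun h => ⟨hplus.2 h, hminus.2 h⟩⟩
  rw [sub_eq_add_neg]
  exact Schatten.add_mem_schattenClass hp (hA i) (hB' j)
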